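/- For real parameters $\eta,\theta$ with $1+\eta\theta\ge 0$, for $0\le s<t$ and $x\in\mathbb R$, let $Q_n(y)=Q_n(y;x,t,s)$ be the monic polynomials in $y$ given by $Q_0=1$, $Q_1=y-x$, $$yQ_1=Q_2+\big((t-s)\eta+\theta\big)Q_1+(t-s)(1+x\eta)Q_0,$$ $$yQ_n=Q_{n+1}+(t\eta+\theta)Q_n+t(1+\eta\theta)Q_{n-1}\qquad(n\ge 2).$$ If $1+x\eta\ge 0$, let $P_{s,t}(x,dy)$ be the unique probability measure on $\mathbb R$ with finite moments that makes the polynomials $(Q_n)_{n\ge0}$ pairwise orthogonal. The (free) bi-Poisson process with parameters $\eta,\theta$ is the real-valued Markov process $(X_t)_{t\ge0}$ with $X_0=0$ almost surely and transition probabilities $P_{s,t}(x,dy)$, that is, $P(X_t\in B\mid X_r,\ 0\le r\le s)=P_{s,t}(X_s,B)$ almost surely for all $0\le s<t$ and all Borel sets $B\subseteq\mathbb R$. (For each $s \geq 0$ one has $1+\eta X_s\ge 0$ almost surely.) **Corollary.** Let $(X_t)_{t\ge 0}$ be a bi-Poisson process with parameters $\eta=\theta\in\mathbb R$ (so that $1+\eta\theta\ge0$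 holds automatically). Then the time-inverted process $(tX_{1/t})_{t>0}$ has the same finite-dimensional distributions as $(X_t)_{t>0}$. -/

import Mathlib

open MeasureTheory ProbabilityTheory
open scoped NNReal ENNReal

namespace BiPoisson

/-- The monic polynomials `Q_n(y; x, t, s)` in the variable `y`, given by
`Q_0 = 1`, `Q_1 = y - x`,
`y Q_1 = Q_2 + ((t - s) η + θ) Q_1 + (t - s) (1 + x η) Q_0`, and
`y Q_n = Q_{n+1} + (t η + θ) Q_n + t (1 + η θ) Q_{n-1}` for `n ≥ 2`. -/
noncomputable def transPoly (η θ s t x : ℝ) : ℕ → Polynomial ℝ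
  | 0 => 1
  | 1 => Polynomial.X - Polynomial.C x
  | 2 => (Polynomial.X - Polynomial.C ((t - s) * η + θ)) * (Polynomial.X - Polynomial.C x)
          - Polynomial.C ((t - s) * (1 + x * η))
  | n + 3 => (Polynomial.X - Polynomial.C (t * η + θ)) * transPoly η θ s t x (n + 2)
          - Polynomial.C (t * (1 + η * θ)) * transPoly η θ s t x (n + 1)

/-- `μ` is a probability measure with finite moments with respect to which the polynomials
`Q 0, Q 1, …` are pairwise orthogonal. -/
def IsOrthogonalityMeasure (Q : ℕ → Polynomial ℝ) (μ : Measure ℝ) : Prop :=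
  IsProbabilityMeasure μ ∧ (∀ n : ℕ, Integrable (fun y : ℝ => y ^ n) μ) ∧
    ∀ m n : ℕ, m ≠ n → ∫ y, (Q m).eval y * (Q n).eval y ∂μ = 0

open Classical in
/-- The transition probability `P_{s,t}(x, dy)`: the (unique) probability measure making the
polynomials `Q_n(y; x, t, s)` orthogonal. It exists for `0 ≤ s < t`, `1 + η θ ≥ 0` and
`1 + x η ≥ 0`; where there is no such measure the value is the zero measure. -/
noncomputable def transition (η θ : ℝ) (s t : ℝ≥0) (x : ℝ) : Measure ℝ :=
  if h : ∃ μ : Measure ℝ, IsOrthogonalityMeasure (transPoly η θ s t x) μ then h.choose else 0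

/-- The `σ`-field `F_s` generated by the random variables `X_r`, `0 ≤ r ≤ s`. -/
abbrev past {Ω : Type*} (X : ℝ≥0 → Ω → ℝ) (s : ℝ≥0) : MeasurableSpace Ω :=
  ⨆ r : ℝ≥0, ⨆ _ : r ≤ s, MeasurableSpace.comap (X r) (borel ℝ)

/-- `(X_t)_{t ≥ 0}` is a (free) bi-Poisson process with parameters `η, θ`: the Markov process
started at `0` with transition probabilities `P_{s,t}(x, dy)`, that is,
`P(X_t ∈ B | F_s) = P_{s,t}(X_s, B)` almost surely for all `0 ≤ s < t` and all Borel sets `B`. -/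
structure IsBiPoissonProcess {Ω : Type*} [MeasurableSpace Ω] (η θ : ℝ)
    (X : ℝ≥0 → Ω → ℝ) (P : Measure Ω) : Prop where
  measurable : ∀ t, Measurable (X t)
  initial : ∀ᵐ ω ∂P, X 0 ω = 0
  markov : ∀ s t : ℝ≥0, s < t → ∀ B : Set ℝ, MeasurableSet B →
    P[(X t ⁻¹' B).indicator (fun _ => (1 : ℝ)) | past X s]
      =ᵐ[P] fun ω => (transition η θ s t (X s ω)).real B

end BiPoisson

/-! Write `M_n(y;t)` for `margPoly η θ t n`. These are martingale polynomials: a linear identity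
between `M_n(·;t)` and the `Q_n(·;x,t,s)` shows that integrating `M_n(·;t)` against `P_{s,t}(x,dy)`
gives `M_n(x;s)`. So on polynomials the transition operator is the purely algebraic map `transOp`,
sending `M_n(·;t)` to `M_n(·;s)` (`map_eq_eval_transOp`, `condExp_eval`).

For `η = θ` the recurrence gives `M_n(ty;t) = t^n M_n(y;1/t)`, while `E[M_n(X_t;t)²] = t^n
(1+η²)^(n-1)` for `n ≥ 1`. In these orthogonal bases the backward transition of `tX_{1/t}` is
therefore diagonal, with powers of `t` that cancel, and it coincides with the forward transition of
`X` (`map_scaleOp_mul_transOp`).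

Iterating along an increasing list of times, expectations of products of polynomials in the
coordinates agree for the two processes. Each `X_t` with `t > 0` is bounded, because its Jacobi
coefficients are, so such expectations determine the finite-dimensional laws
(`measure_ext_of_integral_prod_polynomial`). -/

namespace BiPoisson

open Polynomial

/-- The orthogonal polynomials of the law of `X_t`, started at `0` at time `0`. -/
noncomputable abbrev margPoly (η θ t : ℝ) : ℕ → ℝ[X] := transPoly η θ 0 t 0

/-! ### Martingale polynomials, their norms and their scaling. -/

section Algebra

variable {η θ : ℝ}

theorem margPoly_one (t : ℝ) : margPoly η θ t 1 = X := by
  simp [transPoly]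

theorem X_mul_margPoly_one (t : ℝ) :
    X * margPoly η θ t 1 = margPoly η θ t 2 + C (t * η + θ) * margPoly η θ t 1
      + C t * margPoly η θ t 0 := by
  simp [transPoly]; ring

theorem X_mul_transPoly (s t x : ℝ) (n : ℕ) :
    X * transPoly η θ s t x (n + 2) = transPoly η θ s t x (n + 3)
      + C (t * η + θ) * transPoly η θ s t x (n + 2)
      + C (t * (1 + η * θ)) * transPoly η θ s t x (n + 1) := by
  rw [show transPoly η θ s t x (n + 3) = (X - C (t * η + θ)) * transPoly η θ s t x (n + 2)
          - C (t * (1 + η * θ)) * transPoly η θ s t x (n + 1) by rw [transPoly]]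
  ring

theorem transPoly_degree (s t x : ℝ) : ∀ n, (transPoly η θ s t x n).Monic ∧
    (transPoly η θ s t x n).natDegree = n
  | 0 => by simp [transPoly]
  | 1 => by simp [transPoly, monic_X_sub_C]
  | 2 => by
    have h := (monic_X_sub_C ((t - s) * η + θ)).mul (monic_X_sub_C x)
    have hd : ((X - C ((t - s) * η + θ)) * (X - C x)).natDegree = 2 := by
      rw [(monic_X_sub_C _).natDegree_mul (monic_X_sub_C _), natDegree_X_sub_C, natDegree_X_sub_C]
    have hlt : (C ((t - s) * (1 + x * η))).degree
        < ((X - C ((t - s) * η + θ)) * (X - C x)).degree := by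
      rw [degree_eq_natDegree h.ne_zero, hd]
      exact degree_C_le.trans_lt (by norm_num)
    refine ⟨?_, ?_⟩
    · rw [transPoly]; exact h.sub_of_left hlt
    · rw [transPoly, ← hd]
      exact natDegree_sub_eq_left_of_natDegree_lt (by rw [natDegree_C, hd]; norm_num)
  | n + 3 => by
    obtain ⟨h2, d2⟩ := transPoly_degree s t x (n + 2)
    obtain ⟨h1, d1⟩ := transPoly_degree s t x (n + 1)
    have h := (monic_X_sub_C (t * η + θ)).mul h2
    have hd : ((X - C (t * η + θ)) * transPoly η θ s t x (n + 2)).natDegree = n + 3 := by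
      rw [(monic_X_sub_C _).natDegree_mul h2, d2, natDegree_X_sub_C]; ring
    have hlt : (C (t * (1 + η * θ)) * transPoly η θ s t x (n + 1)).natDegree
        < ((X - C (t * η + θ)) * transPoly η θ s t x (n + 2)).natDegree := by
      rw [hd]
      exact (natDegree_C_mul_le _ _).trans_lt (by omega)
    refine ⟨?_, ?_⟩
    · rw [transPoly]
      refine h.sub_of_left (degree_lt_degree hlt)
    · rw [transPoly, natDegree_sub_eq_left_of_natDegree_lt hlt, hd]

/-- The polynomials `margPoly η θ t` as a polynomial sequence. -/
noncomputable def margSeq (η θ t : ℝ) : Polynomial.Sequence ℝ where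
  elems' := margPoly η θ t
  degree_eq' n := by
    obtain ⟨h, d⟩ := transPoly_degree (η := η) (θ := θ) 0 t 0 n
    rw [degree_eq_natDegree h.ne_zero, d]

/-- The basis of the space of polynomials formed by `margPoly η θ t`. -/
noncomputable def margBasis (η θ t : ℝ) : Module.Basis ℕ ℝ ℝ[X] :=
  (margSeq η θ t).basis fun n => by
    have h : (margSeq η θ t n).leadingCoeff = 1 := (transPoly_degree 0 t 0 n).1
    rw [h]; exact isUnit_one

@[simp] theorem margBasis_apply (t : ℝ) (n : ℕ) : margBasis η θ t n = margPoly η θ t n :=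
  Polynomial.Sequence.basis_eq_self (S := margSeq η θ t) _ n

/-- The action of the transition operator from time `s` to time `t` on polynomials: the linear map
that makes `margPoly` a family of martingale polynomials. -/
noncomputable def transOp (η θ s t : ℝ) : ℝ[X] →ₗ[ℝ] ℝ[X] :=
  (margBasis η θ t).constr ℝ (margPoly η θ s)

@[simp] theorem transOp_margPoly (s t : ℝ) (n : ℕ) :
    transOp η θ s t (margPoly η θ t n) = margPoly η θ s n := by
  rw [transOp, ← margBasis_apply, Module.Basis.constr_basis]

theorem margPoly_one_add (s t x : ℝ) :
    margPoly η θ t 1 + C (s * η + θ - x) = transPoly η θ s t x 1 + C (s * η + θ) := by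
  simp [transPoly]; ring

theorem margPoly_two_add (s t x : ℝ) :
    margPoly η θ t 2 + C (s * η + θ - x) * margPoly η θ t 1 + C (s * (1 + η * θ))
      = transPoly η θ s t x 2 + C θ * transPoly η θ s t x 1 + C (s * η * θ) := by
  simp [transPoly]; ring

/-- The left side is the time-`s` recurrence of `margPoly` at the point `x`, with time-`t`
polynomials in it. A functional killing the right side thus makes its values on `margPoly` obey that
recurrence. Lower indices carry extra constants because the first recurrence step is exceptional. -/
theorem margPoly_add_three (s t x : ℝ) : ∀ n,
    margPoly η θ t (n + 3) + C (s * η + θ - x) * margPoly η θ t (n + 2)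
        + C (s * (1 + η * θ)) * margPoly η θ t (n + 1)
      = transPoly η θ s t x (n + 3) + C θ * transPoly η θ s t x (n + 2)
  | 0 => by simp [transPoly]; ring
  | 1 => by simp [transPoly]; ring
  | n + 2 => by
    have h0 := margPoly_add_three s t x n
    have h1 := margPoly_add_three s t x (n + 1)
    have a1 := X_mul_transPoly (η := η) (θ := θ) 0 t 0 n
    have a2 := X_mul_transPoly (η := η) (θ := θ) 0 t 0 (n + 1)
    have a3 := X_mul_transPoly (η := η) (θ := θ) 0 t 0 (n + 2)
    have b2 := X_mul_transPoly (η := η) (θ := θ) s t x (n + 1)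
    have b3 := X_mul_transPoly (η := η) (θ := θ) s t x (n + 2)
    simp only [add_assoc n, Nat.reduceAdd] at *
    linear_combination (X - C (t * η + θ)) * h1 - C (t * (1 + η * θ)) * h0 - a3
      - C (s * η + θ - x) * a2 - C (s * (1 + η * θ)) * a1 + b3 + C θ * b2

theorem map_C_of_map_one (L : ℝ[X] →ₗ[ℝ] ℝ) (h1 : L 1 = 1) (a : ℝ) : L (C a) = a := by
  rw [← mul_one (C a), ← smul_eq_C_mul, map_smul, h1, smul_eq_mul, mul_one]

/-- The martingale property of `margPoly`, for a functional vanishing on `transPoly`. -/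
theorem map_margPoly_eq_eval (L : ℝ[X] →ₗ[ℝ] ℝ) {s t x : ℝ} (h1 : L 1 = 1)
    (hQ : ∀ n, L (transPoly η θ s t x (n + 1)) = 0) :
    ∀ n, L (margPoly η θ t n) = (margPoly η θ s n).eval x
  | 0 => by simpa [transPoly] using h1
  | 1 => by
    have h := congrArg L (margPoly_one_add (η := η) (θ := θ) s t x)
    rw [map_add, map_add, hQ, map_C_of_map_one L h1, map_C_of_map_one L h1] at h
    rw [margPoly_one s, eval_X]; linarith
  | 2 => by
    have h := congrArg L (margPoly_two_add (η := η) (θ := θ) s t x)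
    have i1 := map_margPoly_eq_eval L h1 hQ 1
    have e := congrArg (eval x) (X_mul_margPoly_one (η := η) (θ := θ) s)
    rw [margPoly_one s, eval_X] at i1
    simp only [L.map_add, C_mul', L.map_smul, smul_eq_mul, map_C_of_map_one L h1] at h
    rw [i1, hQ 0, hQ 1] at h
    simp [margPoly_one] at e
    simp only [margPoly, transPoly, eval_one] at e h ⊢
    linarith
  | n + 3 => by
    have h := congrArg L (margPoly_add_three (η := η) (θ := θ) s t x n)
    have i1 := map_margPoly_eq_eval L h1 hQ (n + 1)
    have i2 := map_margPoly_eq_eval L h1 hQ (n + 2)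
    have e := congrArg (eval x) (X_mul_transPoly (η := η) (θ := θ) 0 s 0 n)
    simp only [L.map_add, C_mul', L.map_smul, smul_eq_mul, i1, i2, eval_add, eval_mul, eval_X,
      eval_smul] at h e
    rw [hQ (n + 2), hQ (n + 1)] at h
    linarith

theorem map_eq_eval_transOp (L : ℝ[X] →ₗ[ℝ] ℝ) {s t x : ℝ} (h1 : L 1 = 1)
    (hQ : ∀ n, L (transPoly η θ s t x (n + 1)) = 0) (f : ℝ[X]) :
    L f = (transOp η θ s t f).eval x := by
  have : L = (Polynomial.leval x) ∘ₗ transOp η θ s t := by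
    refine (margBasis η θ t).ext fun n => ?_
    simp [map_margPoly_eq_eval L h1 hQ n]
  rw [this]; rfl

/-- Multiplication by `X` is tridiagonal with coefficients bounded uniformly in `k`, so each factor
`X` costs at most their sum. The term `|t|` accounts for the exceptional first step. -/
theorem abs_map_X_pow_mul_margPoly_le (L : ℝ[X] →ₗ[ℝ] ℝ) {t : ℝ} (h1 : L 1 = 1)
    (hQ : ∀ n, L (margPoly η θ t (n + 1)) = 0) (n : ℕ) : ∀ k,
    |L (X ^ n * margPoly η θ t k)| ≤ (1 + |t * η + θ| + (|t| + |t * (1 + η * θ)|)) ^ n := by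
  set R := 1 + |t * η + θ| + (|t| + |t * (1 + η * θ)|) with hR
  have p1 := abs_nonneg (t * η + θ)
  have p2 := abs_nonneg t
  have p3 := abs_nonneg (t * (1 + η * θ))
  induction n with
  | zero =>
    rintro (_ | k)
    · simp [transPoly, h1]
    · simp [hQ k]
  | succ n ih =>
    have hRn : 0 ≤ R ^ n := pow_nonneg (by positivity) n
    have step : ∀ (k j : ℕ) (a c : ℝ), |a| ≤ |t * η + θ| → |c| ≤ |t| + |t * (1 + η * θ)| →
        X * margPoly η θ t k = margPoly η θ t (k + 1) + C a * margPoly η θ t k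
          + C c * margPoly η θ t j → |L (X ^ (n + 1) * margPoly η θ t k)| ≤ R ^ (n + 1) := by
      intro k j a c ha hc h
      have e : X ^ (n + 1) * margPoly η θ t k = X ^ n * margPoly η θ t (k + 1)
          + a • (X ^ n * margPoly η θ t k) + c • (X ^ n * margPoly η θ t j) := by
        rw [pow_succ, mul_assoc, h]
        simp only [smul_eq_C_mul]; ring
      rw [e, map_add, map_add, map_smul, map_smul, smul_eq_mul, smul_eq_mul]
      calc _ ≤ |L (X ^ n * margPoly η θ t (k + 1))| + |a| * |L (X ^ n * margPoly η θ t k)|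
            + |c| * |L (X ^ n * margPoly η θ t j)| := by
            rw [← abs_mul, ← abs_mul]
            exact (abs_add_le _ _).trans (add_le_add_left (abs_add_le _ _) _)
        _ ≤ R ^ n + |t * η + θ| * R ^ n + (|t| + |t * (1 + η * θ)|) * R ^ n := by
            gcongr <;> exact ih _
        _ = R ^ (n + 1) := by rw [pow_succ, hR]; ring
    rintro (_ | _ | k)
    · exact step 0 0 0 0 (by simp) (by simpa using add_nonneg p2 p3) (by simp [transPoly])
    · exact step 1 0 _ t le_rfl (by linarith) (X_mul_margPoly_one t)
    · exact step (k + 2) (k + 1) _ _ le_rfl (by linarith) (X_mul_transPoly 0 t 0 k)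

theorem map_margPoly_mul_self (L : ℝ[X] →ₗ[ℝ] ℝ) {t : ℝ} (h1 : L 1 = 1)
    (hQ : ∀ m n, m ≠ n → L (margPoly η θ t m * margPoly η θ t n) = 0) : ∀ n,
    L (margPoly η θ t (n + 1) * margPoly η θ t (n + 1)) = t ^ (n + 1) * (1 + η * θ) ^ n
  | 0 => by
    have e : margPoly η θ t 1 * margPoly η θ t 1 = margPoly η θ t 2 * margPoly η θ t 0
        + (t * η + θ) • (margPoly η θ t 1 * margPoly η θ t 0) + t • 1 := by
      simp [transPoly, smul_eq_C_mul]; ring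
    rw [zero_add, e]
    simp [hQ, h1]
  | n + 1 => by
    have ih := map_margPoly_mul_self L h1 hQ n
    have e2 := X_mul_transPoly (η := η) (θ := θ) 0 t 0 n
    -- Expand `X * M_{n+1} * M_{n+2}` in two ways. The last term of `e1` differs when `n = 0`, but
    -- any index `j < n + 1` is killed by orthogonality.
    obtain ⟨c, j, hj, e1⟩ : ∃ (c : ℝ) (j : ℕ), j < n + 1 ∧
        X * margPoly η θ t (n + 1) = margPoly η θ t (n + 2)
          + C (t * η + θ) * margPoly η θ t (n + 1) + C c * margPoly η θ t j := by
      rcases n with _ | n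
      · exact ⟨t, 0, by omega, X_mul_margPoly_one t⟩
      · exact ⟨_, n + 1, by omega, X_mul_transPoly 0 t 0 n⟩
    have e : margPoly η θ t (n + 2) * margPoly η θ t (n + 2)
        = margPoly η θ t (n + 3) * margPoly η θ t (n + 1)
          + (t * (1 + η * θ)) • (margPoly η θ t (n + 1) * margPoly η θ t (n + 1))
          - c • (margPoly η θ t (n + 2) * margPoly η θ t j) := by
      simp only [smul_eq_C_mul]
      linear_combination margPoly η θ t (n + 1) * e2 - margPoly η θ t (n + 2) * e1
    rw [show n + 1 + 1 = n + 2 from rfl, e, map_sub, map_add, map_smul, map_smul, ih,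
      hQ _ _ (by omega), hQ _ _ (by omega)]
    simp; ring

/-- Rescaling turns the Jacobi coefficients `tη + θ`, `t(1 + ηθ)` into `η + θ/t`, `(1 + ηθ)/t`.
Those at time `1/t` are `η/t + θ`, `(1 + ηθ)/t`, and the two agree because `η = θ`. -/
theorem margPoly_comp_scale {t : ℝ} (ht : t ≠ 0) : ∀ n,
    (margPoly η η t n).comp (C t * X) = C (t ^ n) * margPoly η η (1 / t) n
  | 0 => by simp [transPoly]
  | 1 => by simp [transPoly]
  | 2 => by
    have h : C t * C t⁻¹ = (1 : ℝ[X]) := by rw [← C_mul, mul_inv_cancel₀ ht, C_1]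
    simp [transPoly]
    linear_combination (X * C t * C η + C t) * h
  | n + 3 => by
    have h : C t * C t⁻¹ = (1 : ℝ[X]) := by rw [← C_mul, mul_inv_cancel₀ ht, C_1]
    have i1 := margPoly_comp_scale ht (n + 1)
    have i2 := margPoly_comp_scale ht (n + 2)
    rw [margPoly, transPoly, margPoly, transPoly, sub_comp, mul_comp, mul_comp, i1, i2]
    simp [pow_succ]
    linear_combination (C t ^ (n + 2) * margPoly η η t⁻¹ (n + 2) * C η
      + C t ^ (n + 2) * margPoly η η t⁻¹ (n + 1) * (1 + C η * C η)) * h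

end Algebra

/-! ### Orthogonality measures: integrals of polynomials and bounded support. -/

section Integrals

variable {η θ : ℝ}

theorem integrable_eval {μ : Measure ℝ} (h : ∀ n : ℕ, Integrable (fun y : ℝ => y ^ n) μ)
    (p : ℝ[X]) : Integrable (fun y => p.eval y) μ := by
  induction p using Polynomial.induction_on' with
  | add p q hp hq => simp only [eval_add]; exact hp.add hq
  | monomial n a => simpa only [eval_monomial] using (h n).const_mul a

/-- Integration of polynomials against a measure with finite moments. -/
noncomputable def polyIntegral (μ : Measure ℝ) (h : ∀ n : ℕ, Integrable (fun y : ℝ => y ^ n) μ) :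
    ℝ[X] →ₗ[ℝ] ℝ where
  toFun p := ∫ y, p.eval y ∂μ
  map_add' p q := by
    simp only [eval_add]
    exact integral_add (integrable_eval h p) (integrable_eval h q)
  map_smul' a p := by simp only [eval_smul, smul_eq_mul, integral_const_mul, RingHom.id_apply]

namespace IsOrthogonalityMeasure

variable {s t x : ℝ} {μ : Measure ℝ}

theorem polyIntegral_one (hμ : IsOrthogonalityMeasure (transPoly η θ s t x) μ) :
    polyIntegral μ hμ.2.1 1 = 1 := by
  have := hμ.1
  simp [polyIntegral]

theorem polyIntegral_mul (hμ : IsOrthogonalityMeasure (transPoly η θ s t x) μ) {m n : ℕ}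
    (hmn : m ≠ n) :
    polyIntegral μ hμ.2.1 (transPoly η θ s t x m * transPoly η θ s t x n) = 0 := by
  simpa [polyIntegral] using hμ.2.2 m n hmn

theorem polyIntegral_succ (hμ : IsOrthogonalityMeasure (transPoly η θ s t x) μ) (n : ℕ) :
    polyIntegral μ hμ.2.1 (transPoly η θ s t x (n + 1)) = 0 := by
  have h0 : transPoly η θ s t x 0 = 1 := by rw [transPoly]
  simpa [h0] using hμ.polyIntegral_mul (Nat.succ_ne_zero n)

theorem integral_eval (hμ : IsOrthogonalityMeasure (transPoly η θ s t x) μ) (f : ℝ[X]) :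
    ∫ y, f.eval y ∂μ = (transOp η θ s t f).eval x :=
  map_eq_eval_transOp (polyIntegral μ hμ.2.1) hμ.polyIntegral_one hμ.polyIntegral_succ f

theorem ae_abs_le (hμ : IsOrthogonalityMeasure (margPoly η θ t) μ) :
    ∃ R : ℝ, ∀ᵐ y ∂μ, |y| ≤ R := by
  have := hμ.1
  set R := 1 + |t * η + θ| + (|t| + |t * (1 + η * θ)|) with hR
  have hR0 : 0 < R := by positivity
  refine ⟨R + 1, ?_⟩
  -- Even moments are at most `R ^ (2 * n)`, so Markov's inequality at any level above `R` gives
  -- geometric decay in `n`.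
  have bound : ∀ n : ℕ, μ.real {y | R + 1 ≤ |y|} ≤ ((R / (R + 1)) ^ 2) ^ n := by
    intro n
    have h1 := abs_map_X_pow_mul_margPoly_le (polyIntegral μ hμ.2.1) hμ.polyIntegral_one
      hμ.polyIntegral_succ (2 * n) 0
    have h2 : polyIntegral μ hμ.2.1 (X ^ (2 * n) * margPoly η θ t 0) = ∫ y, y ^ (2 * n) ∂μ := by
      simp [polyIntegral, transPoly]
    rw [h2] at h1
    have h3 := mul_meas_ge_le_integral_of_nonneg (μ := μ) (f := fun y : ℝ => y ^ (2 * n))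
      (.of_forall fun y => (even_two_mul n).pow_nonneg y) (hμ.2.1 (2 * n)) ((R + 1) ^ (2 * n))
    have h4 : μ.real {y | R + 1 ≤ |y|} ≤ μ.real {y | (R + 1) ^ (2 * n) ≤ y ^ (2 * n)} := by
      refine measureReal_mono fun y hy => ?_
      rw [Set.mem_ofPred_eq] at hy ⊢
      calc (R + 1) ^ (2 * n) ≤ |y| ^ (2 * n) := pow_le_pow_left₀ (by positivity) hy _
        _ = y ^ (2 * n) := by rw [pow_mul, sq_abs, ← pow_mul]
    rw [← pow_mul, div_pow, le_div_iff₀ (by positivity), mul_comm]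
    calc _ ≤ (R + 1) ^ (2 * n) * μ.real {y | (R + 1) ^ (2 * n) ≤ y ^ (2 * n)} := by gcongr
      _ ≤ _ := h3.trans ((le_abs_self _).trans h1)
  have hlim : Filter.Tendsto (fun n : ℕ => ((R / (R + 1)) ^ 2) ^ n) Filter.atTop (nhds 0) := by
    refine tendsto_pow_atTop_nhds_zero_of_lt_one (by positivity) ?_
    exact pow_lt_one₀ (by positivity) (by rw [div_lt_one (by positivity)]; linarith) two_ne_zero
  have h0 : μ.real {y | R + 1 ≤ |y|} = 0 :=
    le_antisymm (ge_of_tendsto' hlim bound) measureReal_nonneg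
  rw [measureReal_eq_zero_iff] at h0
  filter_upwards [measure_eq_zero_iff_ae_notMem.1 h0] with y hy
  exact (not_le.1 hy).le

end IsOrthogonalityMeasure

theorem isOrthogonalityMeasure_transition {s t : ℝ≥0} {x : ℝ}
    (h : transition η θ s t x ≠ 0) :
    IsOrthogonalityMeasure (transPoly η θ s t x) (transition η θ s t x) := by
  unfold transition at h ⊢
  split_ifs at h ⊢ with hex
  · exact hex.choose_spec
  · exact absurd rfl h

end Integrals

/-- No measurability of `ν` in `ω` is needed: off one null set it agrees with the regular
conditional distribution on the countably many rational intervals, hence everywhere. -/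
theorem condExp_ae_eq_integral_of_indicator {Ω β : Type*} [MeasurableSpace Ω] {P : Measure Ω}
    [IsFiniteMeasure P] [mβ : MeasurableSpace β] {Z : Ω → β} (hZ : Measurable Z) {Y : Ω → ℝ}
    (hY : Measurable Y) {ν : Ω → Measure ℝ} (hν : ∀ᵐ ω ∂P, IsProbabilityMeasure (ν ω))
    (h : ∀ B, MeasurableSet B → P⟦Y ⁻¹' B | mβ.comap Z⟧ =ᵐ[P] fun ω => (ν ω).real B)
    {f : ℝ → ℝ} (hf : StronglyMeasurable f) (hfY : Integrable (fun ω => f (Y ω)) P) :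
    P[fun ω => f (Y ω) | mβ.comap Z] =ᵐ[P] fun ω => ∫ y, f y ∂ν ω := by
  have key : ∀ᵐ ω ∂P, ∀ a b : ℚ, (condDistrib Y Z P (Z ω)).real (Set.Ioo (a : ℝ) b)
      = (ν ω).real (Set.Ioo (a : ℝ) b) := by
    rw [ae_all_iff]; intro a
    rw [ae_all_iff]; intro b
    exact (condDistrib_ae_eq_condExp hZ hY measurableSet_Ioo).trans (h _ measurableSet_Ioo)
  filter_upwards [condExp_ae_eq_integral_condDistrib hZ hY.aemeasurable hf hfY, key, hν]
    with ω h1 h2 h3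
  rw [h1]
  congr 1
  refine Real.measure_ext_Ioo_rat fun a b => ?_
  exact (measureReal_eq_measureReal_iff).1 (h2 a b)

/-! ### Probabilistic consequences of the Markov property. -/

namespace IsBiPoissonProcess

variable {Ω : Type*} [mΩ : MeasurableSpace Ω] {P : Measure Ω} [IsProbabilityMeasure P]
  {η θ : ℝ} {X : ℝ≥0 → Ω → ℝ}

omit [IsProbabilityMeasure P] in
theorem past_le (hX : IsBiPoissonProcess η θ X P) (s : ℝ≥0) : past X s ≤ mΩ := by
  refine iSup₂_le fun r _ => ?_
  rw [← BorelSpace.measurable_eq (α := ℝ)]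
  exact (hX.measurable r).comap_le

omit mΩ in
theorem measurable_past (X : ℝ≥0 → Ω → ℝ) {r s : ℝ≥0} (h : r ≤ s) :
    Measurable[past X s] (X r) := by
  rw [measurable_iff_comap_le, BorelSpace.measurable_eq (α := ℝ)]
  exact le_iSup₂_of_le r h le_rfl

theorem ae_isOrthogonalityMeasure (hX : IsBiPoissonProcess η θ X P) {s t : ℝ≥0} (hst : s < t) :
    ∀ᵐ ω ∂P, IsOrthogonalityMeasure (transPoly η θ s t (X s ω)) (transition η θ s t (X s ω)) := by
  have h := hX.markov s t hst Set.univ .univ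
  simp only [Set.preimage_univ, Set.indicator_univ] at h
  rw [condExp_const (hX.past_le s)] at h
  filter_upwards [h] with ω hω
  -- The Markov property for `B = univ` forces total mass 1, which rules out the default value `0`.
  refine isOrthogonalityMeasure_transition fun h0 => ?_
  rw [h0] at hω
  simp at hω

theorem isOrthogonalityMeasure_map (hX : IsBiPoissonProcess η θ X P) {t : ℝ≥0} (ht : 0 < t) :
    IsOrthogonalityMeasure (margPoly η θ t) (P.map (X t)) := by
  obtain ⟨ω, h0, horth⟩ := (hX.initial.and (hX.ae_isOrthogonalityMeasure ht)).exists
  rw [h0] at horth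
  have : P.map (X t) = transition η θ 0 t 0 := by
    have := horth.1
    have := Measure.isProbabilityMeasure_map (μ := P) (hX.measurable t).aemeasurable
    refine Measure.ext fun B hB => ?_
    refine (measureReal_eq_measureReal_iff).1 ?_
    rw [map_measureReal_apply (hX.measurable t) hB]
    have h1 := integral_condExp (μ := P) (hX.past_le 0)
      (f := (X t ⁻¹' B).indicator (fun _ => (1 : ℝ)))
    rw [integral_indicator_const _ (hX.measurable t hB)] at h1
    simp only [smul_eq_mul, mul_one] at h1
    rw [← h1, integral_congr_ae (hX.markov 0 t ht B hB)]
    rw [integral_congr_ae (g := fun _ => (transition η θ 0 t 0).real B)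
      (by filter_upwards [hX.initial] with ω hω; rw [hω])]
    simp
  rw [this]
  simpa using horth

theorem ae_abs_le (hX : IsBiPoissonProcess η θ X P) {t : ℝ≥0} (ht : 0 < t) :
    ∃ R : ℝ, ∀ᵐ ω ∂P, |X t ω| ≤ R := by
  obtain ⟨R, hR⟩ := (hX.isOrthogonalityMeasure_map ht).ae_abs_le
  exact ⟨R, ae_of_ae_map (hX.measurable t).aemeasurable hR⟩

omit [IsProbabilityMeasure P] in
theorem integral_eval (hX : IsBiPoissonProcess η θ X P) {t : ℝ≥0} (f : ℝ[X]) :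
    ∫ ω, f.eval (X t ω) ∂P = ∫ y, f.eval y ∂(P.map (X t)) :=
  (integral_map (hX.measurable t).aemeasurable f.continuous.aestronglyMeasurable).symm

theorem integrable_eval (hX : IsBiPoissonProcess η θ X P) {t : ℝ≥0} (ht : 0 < t) (f : ℝ[X]) :
    Integrable (fun ω => f.eval (X t ω)) P :=
  (BiPoisson.integrable_eval (hX.isOrthogonalityMeasure_map ht).2.1 f).comp_measurable (hX.measurable t)

theorem condExp_eval (hX : IsBiPoissonProcess η θ X P) {s t : ℝ≥0} (hst : s < t) (f : ℝ[X]) :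
    P[fun ω => f.eval (X t ω) | past X s] =ᵐ[P] fun ω => (transOp η θ s t f).eval (X s ω) := by
  have ho := hX.ae_isOrthogonalityMeasure hst
  have h := @condExp_ae_eq_integral_of_indicator Ω Ω mΩ P _ (past X s) id
    (measurable_id'' (hX.past_le s)) (X t) (hX.measurable t)
    (fun ω => transition η θ s t (X s ω)) (by filter_upwards [ho] with ω h using h.1)
    (by rw [MeasurableSpace.comap_id]; exact hX.markov s t hst) (fun y => f.eval y)
    f.continuous.stronglyMeasurable (hX.integrable_eval (zero_le.trans_lt hst) f)
  rw [MeasurableSpace.comap_id] at h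
  filter_upwards [h, ho] with ω h1 h2
  rw [h1, h2.integral_eval]

/-- The Markov property, tested against a bounded variable from the past. -/
theorem integral_mul_eval (hX : IsBiPoissonProcess η θ X P) {s t : ℝ≥0} (hst : s < t) (f : ℝ[X])
    {Z : Ω → ℝ} (hZ : Measurable[past X s] Z) {c : ℝ} (hc : ∀ᵐ ω ∂P, |Z ω| ≤ c) :
    ∫ ω, Z ω * f.eval (X t ω) ∂P = ∫ ω, Z ω * (transOp η θ s t f).eval (X s ω) ∂P := by
  have h := condExp_stronglyMeasurable_mul_of_bound (hX.past_le s) (μ := P) hZ.stronglyMeasurable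
    (hX.integrable_eval (zero_le.trans_lt hst) f) c hc
  rw [← integral_condExp (hX.past_le s)]
  refine integral_congr_ae (h.trans ?_)
  filter_upwards [hX.condExp_eval hst f] with ω hω
  rw [Pi.mul_apply, hω]

end IsBiPoissonProcess

/-! ### Moment determinacy for bounded random vectors. -/

section Determinacy

variable {ι : Type*} [Fintype ι] {μ ν : Measure (ι → ℝ)}

theorem integrable_mvPolynomial_eval [IsFiniteMeasure μ] {R : ℝ} (hμ : ∀ᵐ v ∂μ, ∀ i, |v i| ≤ R)
    (q : MvPolynomial ι ℝ) : Integrable (fun v => MvPolynomial.eval v q) μ := by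
  have hcont : Continuous fun v : ι → ℝ => MvPolynomial.eval v q := q.continuous_eval
  obtain ⟨c, hc⟩ := (isCompact_univ_pi fun _ : ι => isCompact_Icc (a := -R) (b := R))
    |>.exists_bound_of_continuousOn hcont.continuousOn
  refine Integrable.of_bound hcont.aestronglyMeasurable c ?_
  filter_upwards [hμ] with v hv
  exact hc v fun i _ => abs_le.1 (hv i)

theorem integral_mvPolynomial_eval_eq [IsFiniteMeasure μ] [IsFiniteMeasure ν] {R : ℝ}
    (hμ : ∀ᵐ v ∂μ, ∀ i, |v i| ≤ R) (hν : ∀ᵐ v ∂ν, ∀ i, |v i| ≤ R)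
    (h : ∀ p : ι → ℝ[X], ∫ v, ∏ i, (p i).eval (v i) ∂μ = ∫ v, ∏ i, (p i).eval (v i) ∂ν)
    (q : MvPolynomial ι ℝ) :
    ∫ v, MvPolynomial.eval v q ∂μ = ∫ v, MvPolynomial.eval v q ∂ν := by
  induction q using MvPolynomial.induction_on' with
  | monomial k a =>
    have := h fun i => X ^ k i
    simp only [eval_pow, eval_X] at this
    simp only [MvPolynomial.eval_monomial, Finsupp.prod_fintype, pow_zero, implies_true,
      integral_const_mul, this]
  | add p q hp hq =>
    simp only [map_add]
    rw [integral_add (integrable_mvPolynomial_eval hμ p) (integrable_mvPolynomial_eval hμ q),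
      integral_add (integrable_mvPolynomial_eval hν p) (integrable_mvPolynomial_eval hν q), hp, hq]

/-- `L` is almost surely bounded, so the exponential series may be integrated termwise. -/
theorem charFunDual_eq_tsum [IsProbabilityMeasure μ] {R : ℝ} (hμ : ∀ᵐ v ∂μ, ∀ i, |v i| ≤ R)
    (L : StrongDual ℝ (ι → ℝ)) :
    charFunDual μ L = ∑' n : ℕ, (Complex.I ^ n / (n.factorial : ℂ)) * ((∫ v, L v ^ n ∂μ : ℝ) : ℂ) := by
  obtain ⟨c, hc⟩ := (isCompact_univ_pi fun _ : ι => isCompact_Icc (a := -R) (b := R))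
    |>.exists_bound_of_continuousOn L.continuous.continuousOn
  have hb : ∀ᵐ v ∂μ, ‖L v‖ ≤ c := by
    filter_upwards [hμ] with v hv using hc v fun i _ => abs_le.1 (hv i)
  have hF : ∀ (n : ℕ), ∀ᵐ v ∂μ, ‖(L v * Complex.I) ^ n / (n.factorial : ℂ)‖
      ≤ c ^ n / (n.factorial : ℝ) := by
    intro n
    filter_upwards [hb] with v hv
    simp only [norm_div, norm_pow, norm_mul, Complex.norm_I, mul_one, Complex.norm_natCast,
      Complex.norm_real]
    gcongr
  have hint : ∀ n : ℕ, Integrable (fun v => (L v * Complex.I) ^ n / (n.factorial : ℂ)) μ :=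
    fun n => Integrable.of_bound (by fun_prop) _ (hF n)
  have hs := hasSum_integral_of_summable_integral_norm hint (by
    refine (Real.summable_pow_div_factorial c).of_nonneg_of_le
      (fun n => integral_nonneg fun v => norm_nonneg _) fun n => ?_
    refine (integral_mono_ae (hint n).norm (integrable_const _) (hF n)).trans (by simp))
  rw [charFunDual_apply]
  calc _ = ∫ v, ∑' n : ℕ, (L v * Complex.I) ^ n / (n.factorial : ℂ) ∂μ := by
        congr 1; ext v
        rw [Complex.exp_eq_exp_ℂ, NormedSpace.exp_eq_tsum_div]
    _ = _ := by
        rw [← hs.tsum_eq]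
        congr 1; ext n
        rw [← integral_complex_ofReal, ← integral_const_mul]
        congr 1; ext v
        push_cast; ring

/-- Two compactly supported laws on a finite product of lines agree as soon as they integrate
products of polynomials in the coordinates in the same way. -/
theorem measure_ext_of_integral_prod_polynomial [IsProbabilityMeasure μ] [IsProbabilityMeasure ν]
    {R : ℝ} (hμ : ∀ᵐ v ∂μ, ∀ i, |v i| ≤ R) (hν : ∀ᵐ v ∂ν, ∀ i, |v i| ≤ R)
    (h : ∀ p : ι → ℝ[X], ∫ v, ∏ i, (p i).eval (v i) ∂μ = ∫ v, ∏ i, (p i).eval (v i) ∂ν) :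
    μ = ν := by
  classical
  refine Measure.ext_of_charFunDual (funext fun L => ?_)
  rw [charFunDual_eq_tsum hμ, charFunDual_eq_tsum hν]
  congr 1; ext n; congr 2
  have e : ∀ v, L v ^ n = MvPolynomial.eval v
      ((∑ i, MvPolynomial.C (L (Pi.single i 1)) * MvPolynomial.X i) ^ n : MvPolynomial ι ℝ) := by
    intro v
    have : L v = ∑ i, L (Pi.single i 1) * v i := by
      conv_lhs => rw [pi_eq_sum_univ' v, map_sum]
      refine Finset.sum_congr rfl fun i _ => ?_
      rw [map_smul, smul_eq_mul, mul_comm]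
    simp [this]
  simp only [e]
  exact integral_mvPolynomial_eval_eq hμ hν h _

end Determinacy

/-! ### Time inversion on polynomials. -/

section Duality

variable {η : ℝ}

/-- The substitution `y ↦ t y`. -/
noncomputable def scaleOp (t : ℝ) : ℝ[X] →ₐ[ℝ] ℝ[X] := aeval (C t * X)

theorem eval_scaleOp (t y : ℝ) (f : ℝ[X]) : (scaleOp t f).eval y = f.eval (t * y) := by
  rw [scaleOp, ← comp_eq_aeval, eval_comp]; simp

theorem scaleOp_margPoly {t : ℝ} (ht : t ≠ 0) (n : ℕ) :
    scaleOp t (margPoly η η t n) = (t ^ n) • margPoly η η (1 / t) n := by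
  rw [scaleOp, ← comp_eq_aeval, margPoly_comp_scale ht, smul_eq_C_mul]

/-- Time inversion takes the transition operator to its adjoint. -/
theorem map_scaleOp_mul_transOp {s t : ℝ} (hs : s ≠ 0) (ht : t ≠ 0) (L L' : ℝ[X] →ₗ[ℝ] ℝ)
    (h1 : L 1 = 1) (h1' : L' 1 = 1)
    (hL : ∀ m n, m ≠ n → L (margPoly η η (1 / t) m * margPoly η η (1 / t) n) = 0)
    (hL' : ∀ m n, m ≠ n → L' (margPoly η η (1 / s) m * margPoly η η (1 / s) n) = 0)
    (f h : ℝ[X]) :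
    L (scaleOp t f * transOp η η (1 / t) (1 / s) h) = L' (scaleOp s (transOp η η s t f) * h) := by
  have key : ((LinearMap.mul ℝ ℝ[X]).compl₁₂ (scaleOp t).toLinearMap
        (transOp η η (1 / t) (1 / s))).compr₂ L
      = ((LinearMap.mul ℝ ℝ[X]).compl₁₂ ((scaleOp s).toLinearMap ∘ₗ transOp η η s t)
        LinearMap.id).compr₂ L' := by
    refine LinearMap.ext_basis (margBasis η η t) (margBasis η η (1 / s)) fun m n => ?_
    simp only [LinearMap.compr₂_apply, LinearMap.compl₁₂_apply, margBasis_apply,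
      AlgHom.toLinearMap_apply, LinearMap.comp_apply, transOp_margPoly, scaleOp_margPoly hs,
      scaleOp_margPoly ht, map_smul, LinearMap.smul_apply, LinearMap.mul_apply', LinearMap.id_apply]
    -- Off the diagonal both sides vanish. On it, for `m ≥ 1`, the factors `t^m` and `(1/t)^m`
    -- cancel, as do those in `s`, leaving `(1 + η²)^(m-1)`.
    rcases eq_or_ne m n with rfl | hmn
    · rcases m with _ | m
      · simp [transPoly, h1, h1']
      · rw [map_margPoly_mul_self L h1 hL, map_margPoly_mul_self L' h1' hL', smul_eq_mul,
          smul_eq_mul, ← mul_assoc, ← mul_assoc, ← mul_pow, ← mul_pow, mul_one_div_cancel hs,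
          mul_one_div_cancel ht]
    · rw [hL m n hmn, hL' m n hmn, smul_zero, smul_zero]
  exact LinearMap.congr_fun₂ key f h

theorem map_scaleOp {t : ℝ} (ht : t ≠ 0) (L L' : ℝ[X] →ₗ[ℝ] ℝ) (h1 : L 1 = 1) (h1' : L' 1 = 1)
    (hL : ∀ n, L (margPoly η η (1 / t) (n + 1)) = 0) (hL' : ∀ n, L' (margPoly η η t (n + 1)) = 0)
    (f : ℝ[X]) : L (scaleOp t f) = L' f := by
  have key : L ∘ₗ (scaleOp t).toLinearMap = L' := by
    refine (margBasis η η t).ext fun n => ?_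
    simp only [LinearMap.comp_apply, AlgHom.toLinearMap_apply, margBasis_apply,
      scaleOp_margPoly ht, map_smul]
    rcases n with _ | n
    · simp [transPoly, h1, h1']
    · rw [hL, hL', smul_zero]
  exact LinearMap.congr_fun key f

end Duality

/-! ### Products over several times. -/

section Chains

/-- The polynomial `g` such that `g (X_s)` is the conditional expectation of the product of
`f t (X_t)` over the increasing list of times `t` past `s`. -/
noncomputable def chainPoly (η θ : ℝ) (f : ℝ≥0 → ℝ[X]) : ℝ≥0 → List ℝ≥0 → ℝ[X]
  | _, [] => 1
  | s, t :: l => transOp η θ s t (f t * chainPoly η θ f t l)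

theorem exists_ae_abs_mul_le {Ω : Type*} [MeasurableSpace Ω] {P : Measure Ω} {u v : Ω → ℝ}
    (hu : ∃ c, ∀ᵐ ω ∂P, |u ω| ≤ c) (hv : ∃ c, ∀ᵐ ω ∂P, |v ω| ≤ c) :
    ∃ c, ∀ᵐ ω ∂P, |u ω * v ω| ≤ c := by
  obtain ⟨a, ha⟩ := hu
  obtain ⟨b, hb⟩ := hv
  refine ⟨a * b, ?_⟩
  filter_upwards [ha, hb] with ω h1 h2
  rw [abs_mul]
  exact mul_le_mul h1 h2 (abs_nonneg _) ((abs_nonneg _).trans h1)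

theorem exists_ae_abs_list_prod_le {Ω ι : Type*} [MeasurableSpace Ω] {P : Measure Ω}
    {u : ι → Ω → ℝ} : ∀ {l : List ι}, (∀ i ∈ l, ∃ c, ∀ᵐ ω ∂P, |u i ω| ≤ c) →
      ∃ c, ∀ᵐ ω ∂P, |(l.map fun i => u i ω).prod| ≤ c
  | [], _ => ⟨1, by simp⟩
  | i :: l, h => by
    simp only [List.map_cons, List.prod_cons]
    exact exists_ae_abs_mul_le (h i (by simp))
      (exists_ae_abs_list_prod_le fun j hj => h j (by simp [hj]))

theorem measurable_list_map_prod {Ω ι : Type*} {m : MeasurableSpace Ω} {u : ι → Ω → ℝ} :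
    ∀ {l : List ι}, (∀ i ∈ l, Measurable (u i)) → Measurable fun ω => (l.map fun i => u i ω).prod
  | [], _ => by simp
  | i :: l, h => by
    simp only [List.map_cons, List.prod_cons]
    exact (h i (by simp)).mul (measurable_list_map_prod fun j hj => h j (by simp [hj]))

namespace IsBiPoissonProcess

variable {Ω : Type*} [mΩ : MeasurableSpace Ω] {P : Measure Ω} [IsProbabilityMeasure P]
  {η θ : ℝ} {X : ℝ≥0 → Ω → ℝ}

theorem exists_ae_abs_eval_le (hX : IsBiPoissonProcess η θ X P) {t : ℝ≥0} (ht : 0 < t)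
    (f : ℝ[X]) : ∃ c, ∀ᵐ ω ∂P, |f.eval (X t ω)| ≤ c := by
  obtain ⟨R, hR⟩ := hX.ae_abs_le ht
  obtain ⟨c, hc⟩ := (isCompact_Icc (a := -R) (b := R)).exists_bound_of_continuousOn
    f.continuous.continuousOn
  exact ⟨c, by filter_upwards [hR] with ω h using hc _ (abs_le.1 h)⟩

/-- The arbitrary `Z` lets the induction absorb the earliest factor into the past. -/
theorem integral_mul_prod_eval (hX : IsBiPoissonProcess η θ X P) (f : ℝ≥0 → ℝ[X]) :
    ∀ {s : ℝ≥0} {l : List ℝ≥0}, (s :: l).Pairwise (· < ·) → ∀ {Z : Ω → ℝ},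
      Measurable[past X s] Z → (∃ c, ∀ᵐ ω ∂P, |Z ω| ≤ c) →
      ∫ ω, Z ω * (l.map fun t => (f t).eval (X t ω)).prod ∂P
        = ∫ ω, Z ω * (chainPoly η θ f s l).eval (X s ω) ∂P
  | s, [], _, Z, _, _ => by simp [chainPoly]
  | s, t :: l, h, Z, hZ, hc => by
    have hst : s < t := (List.pairwise_cons.1 h).1 t (by simp)
    have hle : past X s ≤ past X t := iSup₂_mono' fun r hr => ⟨r, hr.trans hst.le, le_rfl⟩
    have hft : Measurable[past X t] fun ω => (f t).eval (X t ω) :=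
      (f t).continuous.measurable.comp (measurable_past X le_rfl)
    have ih := integral_mul_prod_eval hX f (List.pairwise_cons.1 h).2
      (Z := fun ω => Z ω * (f t).eval (X t ω)) ((hZ.mono hle le_rfl).mul hft)
      (exists_ae_abs_mul_le hc (hX.exists_ae_abs_eval_le (zero_le.trans_lt hst) _))
    obtain ⟨c, hc⟩ := hc
    simp only [List.map_cons, List.prod_cons, ← mul_assoc]
    rw [ih, chainPoly, ← hX.integral_mul_eval hst _ hZ hc]
    simp only [eval_mul, mul_assoc]

/-- The backward transition operator of `X`, after time inversion. -/
theorem integral_scaled_mul_eval (hX : IsBiPoissonProcess η η X P) {s t : ℝ≥0} (hs : 0 < s)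
    (ht : 0 < t) (f h : ℝ[X]) :
    ∫ ω, f.eval (t * X (1 / t) ω) * (transOp η η ((1 / t : ℝ≥0) : ℝ) ((1 / s : ℝ≥0) : ℝ) h).eval
        (X (1 / t) ω) ∂P
      = ∫ ω, (transOp η η s t f).eval (s * X (1 / s) ω) * h.eval (X (1 / s) ω) ∂P := by
  have ot := hX.isOrthogonalityMeasure_map (one_div_pos.2 ht)
  have os := hX.isOrthogonalityMeasure_map (one_div_pos.2 hs)
  simp only [← eval_scaleOp, ← eval_mul, hX.integral_eval]
  have key := map_scaleOp_mul_transOp (η := η) (s := s) (t := t) (by exact_mod_cast hs.ne')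
    (by exact_mod_cast ht.ne') _ _ ot.polyIntegral_one os.polyIntegral_one
    (fun m n hmn => by simpa using ot.polyIntegral_mul hmn)
    (fun m n hmn => by simpa using os.polyIntegral_mul hmn) f h
  simpa [polyIntegral] using key

theorem integral_scaled_eval (hX : IsBiPoissonProcess η η X P) {t : ℝ≥0} (ht : 0 < t) (f : ℝ[X]) :
    ∫ ω, f.eval (t * X (1 / t) ω) ∂P = ∫ ω, f.eval (X t ω) ∂P := by
  have ot := hX.isOrthogonalityMeasure_map (one_div_pos.2 ht)
  have os := hX.isOrthogonalityMeasure_map ht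
  simp only [← eval_scaleOp, hX.integral_eval]
  exact map_scaleOp (η := η) (t := t) (by exact_mod_cast ht.ne') _ _ ot.polyIntegral_one
    os.polyIntegral_one (fun n => by simpa using ot.polyIntegral_succ n) os.polyIntegral_succ f

theorem integral_scaled_prod_mul_eval (hX : IsBiPoissonProcess η η X P) (f : ℝ≥0 → ℝ[X]) :
    ∀ {s : ℝ≥0} {l : List ℝ≥0}, 0 < s → (s :: l).Pairwise (· < ·) → ∀ h : ℝ[X],
      ∫ ω, (l.map fun t => (f t).eval (t * X (1 / t) ω)).prod * h.eval (X (1 / s) ω) ∂P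
        = ∫ ω, (chainPoly η η f s l).eval (s * X (1 / s) ω) * h.eval (X (1 / s) ω) ∂P
  | s, [], _, _, h => by simp [chainPoly]
  | s, t :: l, hs, hl, h => by
    have hst : s < t := (List.pairwise_cons.1 hl).1 t (by simp)
    have ht := hs.trans hst
    have hl' := (List.pairwise_cons.1 hl).2
    have hle : ∀ r ∈ t :: l, t ≤ r := by
      rintro r hr
      rcases List.mem_cons.1 hr with rfl | hr
      · exact le_rfl
      · exact ((List.pairwise_cons.1 hl').1 r hr).le
    have hm : Measurable[past X (1 / t)] fun ω =>
        ((t :: l).map fun t => (f t).eval (t * X (1 / t) ω)).prod := by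
      refine measurable_list_map_prod fun r hr => ?_
      exact (f r).continuous.measurable.comp
        ((measurable_past X (one_div_le_one_div_of_le ht (hle r hr))).const_mul _)
    have hb : ∃ c, ∀ᵐ ω ∂P, |((t :: l).map fun t => (f t).eval (t * X (1 / t) ω)).prod| ≤ c := by
      refine exists_ae_abs_list_prod_le fun r hr => ?_
      simp only [← eval_scaleOp]
      exact hX.exists_ae_abs_eval_le (one_div_pos.2 (ht.trans_le (hle r hr))) _
    obtain ⟨c, hc⟩ := hb
    -- Inversion reverses time: the whole product lies in the past of `1/t`, and `1/s` is later.
    -- Conditioning moves `h` from `1/s` to `1/t`; duality then turns this into a forward step from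
    -- `s` to `t` on the other factor.
    rw [hX.integral_mul_eval (one_div_lt_one_div_of_lt hs hst) h hm hc]
    have ih := integral_scaled_prod_mul_eval hX f ht hl'
      (scaleOp t (f t) * transOp η η ((1 / t : ℝ≥0) : ℝ) ((1 / s : ℝ≥0) : ℝ) h)
    rw [chainPoly, ← hX.integral_scaled_mul_eval hs ht]
    simp only [eval_mul, eval_scaleOp] at ih ⊢
    simp only [List.map_cons, List.prod_cons]
    calc _ = _ := by congr 1; ext ω; ring
      _ = _ := ih
      _ = _ := by congr 1; ext ω; ring

theorem integral_scaled_prod_eq (hX : IsBiPoissonProcess η η X P) (f : ℝ≥0 → ℝ[X])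
    {l : List ℝ≥0} (hpos : ∀ t ∈ l, 0 < t) (hl : l.Pairwise (· < ·)) :
    ∫ ω, (l.map fun t => (f t).eval (t * X (1 / t) ω)).prod ∂P
      = ∫ ω, (l.map fun t => (f t).eval (X t ω)).prod ∂P := by
  rcases l with _ | ⟨t, l⟩
  · rfl
  have ht : 0 < t := hpos t (by simp)
  -- The factor at the smallest time `t` serves as the test polynomial, leaving only the
  -- one-dimensional laws to compare.
  have h1 := hX.integral_scaled_prod_mul_eval f ht hl (scaleOp t (f t))
  have h2 := hX.integral_mul_prod_eval f hl (Z := fun ω => (f t).eval (X t ω))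
    ((f t).continuous.measurable.comp (measurable_past X le_rfl)) (hX.exists_ae_abs_eval_le ht _)
  simp only [List.map_cons, List.prod_cons]
  rw [h2]
  simp only [eval_scaleOp, ← eval_mul] at h1 ⊢
  rw [← hX.integral_scaled_eval ht, mul_comm (f t), ← h1]
  congr 1; ext ω; ring

end IsBiPoissonProcess

end Chains

/-! ### Finite-dimensional distributions. -/

namespace IsBiPoissonProcess

variable {Ω : Type*} [mΩ : MeasurableSpace Ω] {P : Measure Ω} [IsProbabilityMeasure P]
  {η : ℝ} {X : ℝ≥0 → Ω → ℝ}

theorem integral_scaled_prod_finset_eq (hX : IsBiPoissonProcess η η X P)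
    (I : Finset (Set.Ioi (0 : ℝ≥0))) (p : I → Polynomial ℝ) :
    ∫ ω, ∏ i : I, (p i).eval ((((i : Set.Ioi (0 : ℝ≥0)) : ℝ≥0) : ℝ) * X (1 / i) ω) ∂P
      = ∫ ω, ∏ i : I, (p i).eval (X i ω) ∂P := by
  set e : I ↪ ℝ≥0 := ⟨fun i => ((i : Set.Ioi (0 : ℝ≥0)) : ℝ≥0),
    Subtype.val_injective.comp Subtype.val_injective⟩ with he
  set f : ℝ≥0 → Polynomial ℝ := Function.extend e p 1
  have hf : ∀ i, f (e i) = p i := fun i => e.injective.extend_apply p 1 i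
  set l := (Finset.univ.map e).sort (· ≤ ·) with hl
  have hprod : ∀ g : ℝ≥0 → ℝ, (l.map g).prod = ∏ i : I, g (e i) := by
    intro g
    rw [← Finset.prod_map Finset.univ e g, Finset.prod_eq_multiset_prod,
      ← Finset.sort_eq (Finset.univ.map e) (· ≤ ·), Multiset.map_coe, Multiset.prod_coe]
  have hpos : ∀ t ∈ l, 0 < t := by
    intro t ht
    rw [hl, Finset.mem_sort, Finset.mem_map] at ht
    obtain ⟨i, -, rfl⟩ := ht
    exact i.1.2
  have key := hX.integral_scaled_prod_eq f hpos (Finset.sortedLT_sort _).pairwise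
  simp only [hprod, hf] at key
  exact key

end IsBiPoissonProcess

end BiPoisson

theorem mainTheorem3 {Ω : Type*} [MeasurableSpace Ω] (P : Measure Ω) [IsProbabilityMeasure P]
    (η θ : ℝ) (hηθ : η = θ) (X : ℝ≥0 → Ω → ℝ)
    (hX : BiPoisson.IsBiPoissonProcess η θ X P) :
    ∀ I : Finset (Set.Ioi (0 : ℝ≥0)),
      IdentDistrib (fun ω (t : I) => ((t : Set.Ioi (0 : ℝ≥0)) : ℝ) * X (1 / t) ω)
        (fun ω (t : I) => X t ω) P P := by
  intro I
  subst hηθ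
  have m1 : Measurable fun ω (t : I) =>
      (((t : Set.Ioi (0 : ℝ≥0)) : ℝ≥0) : ℝ) * X (1 / t) ω :=
    measurable_pi_lambda _ fun t => (hX.measurable _).const_mul _
  have m2 : Measurable fun ω (t : I) => X t ω := measurable_pi_lambda _ fun t => hX.measurable _
  refine ⟨m1.aemeasurable, m2.aemeasurable, ?_⟩
  have := Measure.isProbabilityMeasure_map (μ := P) m1.aemeasurable
  have := Measure.isProbabilityMeasure_map (μ := P) m2.aemeasurable
  have b1 : ∀ t : I, ∃ c, ∀ᵐ ω ∂P,
      |(((t : Set.Ioi (0 : ℝ≥0)) : ℝ≥0) : ℝ) * X (1 / t) ω| ≤ c := fun t =>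
    BiPoisson.exists_ae_abs_mul_le ⟨_, .of_forall fun _ => le_rfl⟩
      (hX.ae_abs_le (one_div_pos.2 t.1.2))
  have b2 : ∀ t : I, ∃ c, ∀ᵐ ω ∂P, |X t ω| ≤ c := fun t => hX.ae_abs_le t.1.2
  choose c1 hc1 using b1
  choose c2 hc2 using b2
  -- A sum gives a common bound for all coordinates, even when `I` is empty.
  have hle : ∀ t : I, max (c1 t) (c2 t) ≤ ∑ i, |max (c1 i) (c2 i)| := fun t =>
    (le_abs_self _).trans
      (Finset.single_le_sum (f := fun i => |max (c1 i) (c2 i)|) (fun i _ => abs_nonneg _)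
        (Finset.mem_univ t))
  have hms : MeasurableSet {v : I → ℝ | ∀ i, |v i| ≤ ∑ i, |max (c1 i) (c2 i)|} := by
    simp only [Set.ofPred_forall]
    exact .iInter fun i => measurableSet_le (measurable_pi_apply i).abs measurable_const
  refine BiPoisson.measure_ext_of_integral_prod_polynomial
    (R := ∑ i, |max (c1 i) (c2 i)|) ?_ ?_ fun p => ?_
  · rw [ae_map_iff m1.aemeasurable hms, ae_all_iff]
    intro t
    filter_upwards [hc1 t] with ω h using h.trans ((le_max_left _ _).trans (hle t))
  · rw [ae_map_iff m2.aemeasurable hms, ae_all_iff]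
    intro t
    filter_upwards [hc2 t] with ω h using h.trans ((le_max_right _ _).trans (hle t))
  · have hcont : Continuous fun v : I → ℝ => ∏ i, (p i).eval (v i) :=
      continuous_finsetProd _ fun i _ => (p i).continuous.comp (continuous_apply i)
    rw [integral_map m1.aemeasurable hcont.aestronglyMeasurable,
      integral_map m2.aemeasurable hcont.aestronglyMeasurable]
    exact hX.integral_scaled_prod_finset_eq I p
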